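/- Let $n\ge 0$, write $\underline x=x_1,\dots,x_n$ and $\partial_i=\partial/\partial x_i$, and let $f\in\mathbb C[[\underline x]]$ be a formal power series such that $$\langle x_1,\dots,x_n\rangle^k\subseteq\langle\partial_1(f),\dots,\partial_n(f)\rangle\quad\text{in } \mathbb C[[\underline x]]\text{ for some }k\ge 0$$ (for instance, the Taylor series of a germ of a holomorphic function at $0\in\mathbb C^n$ with an isolated critical point at $0$). Then the Milnor number $$\mu=\dim_{\mathbb C}\bigl(\mathbb C[[\underline x]]/\langle\partial_1(f),\dots,\partial_n(f)\rangle\bigr)$$ is finite. Consider the power series ring $\mathbb C[[s,\underline x]]=\mathbb C[[\underline x]][[s]]$ as a $\mathbb C[[s]]$-module, with $\partial_i$ acting $\mathbb C[[s]]$-linearly by differentiating the coefficient of each power of $s$, and let $H$ be the cokernel of the $\mathbb C[[s]]$-linear map $$\underline\partial(f)-s\underline\partial:\ \mathbb C[[s,\underline x]]^n\longrightarrow\mathbb C[[s,\underline x]],\qquad (g_1,\dots,g_n)\longmapsto\sum_{i=1}^n\bigl(\partial_i(f)\,g_i-s\,\partial_i(g_i)\bigr).$$ Then $H$ is a free $\mathbb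 C[[s]]$-module of rank $\mu$. -/

import Mathlib

namespace FormalBrieskorn

noncomputable section

/-- The ring `ℂ[[x]] = ℂ[[x₁, …, xₙ]]`. -/
abbrev XSeries (n : ℕ) : Type := MvPowerSeries (Fin n) ℂ

/-- The ring `ℂ[[s, x]]`, written as `ℂ[[x]][[s]]`: a series is the sequence of its coefficients
in `ℂ[[x]]` at the powers of `s`, and the variable `s` is `PowerSeries.X`.  Its `ℂ[[s]]`-module
structure is the canonical one, given by the inclusion `ℂ[[s]] ⊆ ℂ[[x]][[s]]`. -/
abbrev SXSeries (n : ℕ) : Type := PowerSeries (XSeries n)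

/-- The ideal `⟨x⟩ = ⟨x₁, …, xₙ⟩` of `ℂ[[x]]`. -/
def varIdeal (n : ℕ) : Ideal (XSeries n) :=
  Ideal.span (Set.range fun i : Fin n => (MvPowerSeries.X i : XSeries n))

/-- The Jacobian ideal `⟨∂₁(f), …, ∂ₙ(f)⟩` of `ℂ[[x]]`. -/
def jacobianIdeal {n : ℕ} (f : XSeries n) : Ideal (XSeries n) :=
  Ideal.span (Set.range fun i : Fin n => MvPowerSeries.pderiv ℂ i f)

/-- The Milnor number `μ = dim_ℂ ℂ[[x]] / ⟨∂₁(f), …, ∂ₙ(f)⟩`. -/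
def milnorNumber {n : ℕ} (f : XSeries n) : ℕ :=
  Module.finrank ℂ (XSeries n ⧸ jacobianIdeal f)

/-- The partial derivative `∂ᵢ = ∂/∂xᵢ` on `ℂ[[s, x]]`, a `ℂ[[s]]`-linear map: it differentiates
the coefficient of each power of `s`. -/
def partialX {n : ℕ} (i : Fin n) : SXSeries n →ₗ[PowerSeries ℂ] SXSeries n where
  toFun g := PowerSeries.mk fun k => MvPowerSeries.pderiv ℂ i (PowerSeries.coeff k g)
  map_add' g h := by
    ext1 k
    simp
  map_smul' a g := by
    ext1 k
    simp only [Algebra.smul_def, PowerSeries.algebraMap_apply'', PowerSeries.coeff_mk,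
      PowerSeries.coeff_mul, PowerSeries.coeff_map, map_sum, RingHom.id_apply]
    refine Finset.sum_congr rfl fun p _ => ?_
    rw [← Algebra.smul_def, ← Algebra.smul_def, Derivation.map_smul]

/-- The differential operator `Fᵢ = ∂ᵢ(f) - s ∂ᵢ` on `ℂ[[s, x]]`, a `ℂ[[s]]`-linear map. -/
def brieskornOperator {n : ℕ} (f : XSeries n) (i : Fin n) :
    SXSeries n →ₗ[PowerSeries ℂ] SXSeries n :=
  LinearMap.mulLeft (PowerSeries ℂ) (PowerSeries.C (MvPowerSeries.pderiv ℂ i f) : SXSeries n) -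
    (PowerSeries.X : PowerSeries ℂ) • partialX i

/-- The `ℂ[[s]]`-linear map `F = ∂(f) - s ∂ : ℂ[[s, x]]ⁿ → ℂ[[s, x]]`,
`(g₁, …, gₙ) ↦ ∑ᵢ (∂ᵢ(f) gᵢ - s ∂ᵢ(gᵢ))`. -/
def brieskornMap {n : ℕ} (f : XSeries n) :
    (Fin n → SXSeries n) →ₗ[PowerSeries ℂ] SXSeries n :=
  ∑ i, brieskornOperator f i ∘ₗ LinearMap.proj i

/-- The `ℂ[[s]]`-module `H = ℂ[[s, x]] / ⟨∂(f) - s ∂⟩ ℂ[[s, x]]`, the cokernel of `F`. -/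
abbrev brieskornModule {n : ℕ} (f : XSeries n) : Type :=
  SXSeries n ⧸ LinearMap.range (brieskornMap f)

/-- The explicit formula for `F`. -/
theorem brieskornMap_apply {n : ℕ} (f : XSeries n) (g : Fin n → SXSeries n) :
    brieskornMap f g = ∑ i, (PowerSeries.C (MvPowerSeries.pderiv ℂ i f) * g i -
      PowerSeries.X * partialX i (g i)) := by
  simp [brieskornMap, brieskornOperator, Algebra.smul_def, PowerSeries.algebraMap_apply'']

end

end FormalBrieskorn

/-! Setting `s = 0` turns `F` into `g ↦ ∑ ∂ᵢ(f) gᵢ`, so `H/sH` is the Jacobian algebra. A basis of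
it lifts to generators of `H` by successive division by `s`, and to independent elements as soon as
`s` is injective on `H`.

For injectivity, let `s h = F(g)`. The constant term of `g` is a syzygy of the `∂ᵢ(f)`. If it is a
Koszul syzygy, it lifts to an element of `ker F`, because the operators `Fᵢ` commute; subtracting
the lift and dividing by `s` gives `h ∈ im F`.

All syzygies are Koszul because the Jacobian ideal has `n` generators and contains the regular
sequence `xᵢᵏ` of length `n`. `GradeGE.exchange` makes the available grade independent of the chosen
sequence, and `GradeGE.exists_koszul` inducts along generic combinations of the generators.
Regularity is weak throughout, so the unit ideal needs no separate case. -/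

namespace FormalBrieskorn

/-! ### Grade, prime avoidance and Koszul syzygies -/

section Grade

variable {R : Type*} [CommRing R]

/-- `a` is a nonzerodivisor modulo the ideal `I`. -/
def IsRegularMod (I : Ideal R) (a : R) : Prop := ∀ x, a * x ∈ I → x ∈ I

/-- The ideal `J` contains a sequence of length `n` which is weakly regular on `R ⧸ I`. -/
def GradeGE (J : Ideal R) : ℕ → Ideal R → Prop
  | 0, _ => True
  | n + 1, I => ∃ a ∈ J, IsRegularMod I a ∧ GradeGE J n (I ⊔ Ideal.span {a})

theorem mem_sup_span_singleton_iff {I : Ideal R} {a x : R} :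
    x ∈ I ⊔ Ideal.span {a} ↔ ∃ t, x - a * t ∈ I := by
  rw [Submodule.mem_sup]
  constructor
  · rintro ⟨y, hy, z, hz, rfl⟩
    obtain ⟨t, rfl⟩ := Ideal.mem_span_singleton.1 hz
    exact ⟨t, by simpa using hy⟩
  · rintro ⟨t, ht⟩
    exact ⟨_, ht, a * t, Ideal.mem_span_singleton.2 ⟨t, rfl⟩, by ring⟩

/-- Outside finitely many primes not containing `J`, every element is regular modulo `I`,
as soon as no element outside `I` is carried into `I` by `J`. -/
theorem exists_finite_primes [IsNoetherianRing R] {I J : Ideal R}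
    (h : ∀ m, (∀ j ∈ J, j * m ∈ I) → m ∈ I) :
    ∃ S : Set (Ideal R), S.Finite ∧ (∀ P ∈ S, P.IsPrime ∧ ¬ J ≤ P) ∧
      ∀ a, (∀ P ∈ S, a ∉ P) → IsRegularMod I a := by
  -- An associated prime is the annihilator of some class `y`; if it contained `J`, then `J` would
  -- kill `y`, forcing `y ∈ I`.
  refine ⟨associatedPrimes R (R ⧸ I), associatedPrimes.finite R _, fun P hP => ?_,
    fun a ha x hx => ?_⟩
  · obtain ⟨hp, x, hx⟩ := isAssociatedPrime_iff.1 hP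
    refine ⟨hp, fun hJ => hp.ne_top ?_⟩
    obtain ⟨y, rfl⟩ := Ideal.Quotient.mk_surjective x
    have hy : y ∈ I := h y fun j hj => by
      have := hJ hj
      rw [hx, Submodule.mem_colon_singleton, Submodule.mem_bot, ← Ideal.Quotient.mk_eq_mk,
        ← Submodule.Quotient.mk_smul, Submodule.Quotient.mk_eq_zero] at this
      exact this
    rw [hx, Ideal.eq_top_iff_one, Submodule.mem_colon_singleton, Ideal.Quotient.eq_zero_iff_mem.2 hy]
    simp
  · by_contra hxI
    have : a ∈ ⋃ p ∈ associatedPrimes R (R ⧸ I), (p : Set R) := by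
      rw [biUnion_associatedPrimes_eq_zero_divisors]
      refine ⟨Ideal.Quotient.mk I x, fun h0 => hxI (Ideal.Quotient.eq_zero_iff_mem.1 h0), ?_⟩
      rw [← Ideal.Quotient.mk_eq_mk, ← Submodule.Quotient.mk_smul, Submodule.Quotient.mk_eq_zero]
      exact hx
    obtain ⟨P, hP, haP⟩ := Set.mem_iUnion₂.1 this
    exact ha P hP haP

theorem GradeGE.mem_of_forall_mul_mem {J I : Ideal R} {n : ℕ} (h : GradeGE J (n + 1) I) (m : R)
    (hm : ∀ j ∈ J, j * m ∈ I) : m ∈ I := by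
  obtain ⟨a, ha, hr, -⟩ := h
  exact hr m (hm a ha)

theorem IsRegularMod.swap {I : Ideal R} {a b : R} (ha : IsRegularMod I a)
    (hab : IsRegularMod (I ⊔ Ideal.span {a}) b) : IsRegularMod (I ⊔ Ideal.span {b}) a := by
  intro x hx
  obtain ⟨y, hy⟩ := mem_sup_span_singleton_iff.1 hx
  have h1 : y ∈ I ⊔ Ideal.span {a} := hab y (mem_sup_span_singleton_iff.2 ⟨x, by
    simpa using I.neg_mem hy⟩)
  obtain ⟨z, hz⟩ := mem_sup_span_singleton_iff.1 h1
  refine mem_sup_span_singleton_iff.2 ⟨z, ha _ ?_⟩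
  have := I.add_mem hy (I.mul_mem_left b hz)
  convert this using 1
  ring

/-- Write `a m ≡ b m'` modulo `I`. Cancelling `b` shows that `J` kills `m'` modulo `a`, so `m' ≡ a
t`, and cancelling `a` gives `m ≡ b t`. Behind this is `Hom(R/J, R/(I + (a))) ≅ Ext¹(R/J, R/I)` for
regular `a ∈ J`. -/
theorem forall_mul_mem_exchange {I J : Ideal R} {a b : R} (ha : a ∈ J)
    (hra : IsRegularMod I a) (hrb : IsRegularMod I b)
    (h : ∀ m, (∀ j ∈ J, j * m ∈ I ⊔ Ideal.span {a}) → m ∈ I ⊔ Ideal.span {a}) (m : R)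
    (hm : ∀ j ∈ J, j * m ∈ I ⊔ Ideal.span {b}) : m ∈ I ⊔ Ideal.span {b} := by
  obtain ⟨m', hm'⟩ := mem_sup_span_singleton_iff.1 (hm a ha)
  have h1 : m' ∈ I ⊔ Ideal.span {a} := h m' fun j hj => by
    obtain ⟨t, ht⟩ := mem_sup_span_singleton_iff.1 (hm j hj)
    refine mem_sup_span_singleton_iff.2 ⟨t, hrb _ ?_⟩
    have := I.sub_mem (I.mul_mem_left a ht) (I.mul_mem_left j hm')
    convert this using 1
    ring
  obtain ⟨t, ht⟩ := mem_sup_span_singleton_iff.1 h1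
  refine mem_sup_span_singleton_iff.2 ⟨t, hra _ ?_⟩
  have := I.add_mem hm' (I.mul_mem_left b ht)
  convert this using 1
  ring

/-- Prime avoidance gives `c ∈ J` regular modulo `I`, `I + (a)` and `I + (b)` at once. Induction
then replaces `a, c` by `c, a`, and `a` by `b` modulo `c`. -/
theorem GradeGE.exchange [IsNoetherianRing R] {J : Ideal R} (n : ℕ) :
    ∀ (I : Ideal R) (b : R), b ∈ J → IsRegularMod I b → GradeGE J (n + 1) I →
      GradeGE J n (I ⊔ Ideal.span {b}) := by
  induction n with
  | zero => exact fun _ _ _ _ _ => trivial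
  | succ n ih =>
    intro I b hb hrb hI
    have hNI := hI.mem_of_forall_mul_mem
    obtain ⟨a, ha, hra, hIa⟩ := hI
    have hNa := hIa.mem_of_forall_mul_mem
    obtain ⟨S₀, hf₀, hp₀, hr₀⟩ := exists_finite_primes hNI
    obtain ⟨S₁, hf₁, hp₁, hr₁⟩ := exists_finite_primes hNa
    obtain ⟨S₂, hf₂, hp₂, hr₂⟩ :=
      exists_finite_primes (forall_mul_mem_exchange ha hra hrb hNa)
    have hp : ∀ P ∈ S₀ ∪ S₁ ∪ S₂, P.IsPrime ∧ ¬ J ≤ P := by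
      rintro P ((h | h) | h)
      exacts [hp₀ P h, hp₁ P h, hp₂ P h]
    have hJ : ¬ (J : Set R) ⊆ ⋃ P ∈ S₀ ∪ S₁ ∪ S₂, (P : Set R) := fun h => by
      obtain ⟨P, hP, hle⟩ := (Ideal.subset_union_prime_finite ((hf₀.union hf₁).union hf₂)
        (f := fun P => P) ⊥ ⊥ fun P hP _ _ => (hp P hP).1).1 h
      exact (hp P hP).2 hle
    obtain ⟨c, hc, hcS⟩ := Set.not_subset.1 hJ
    have hcS : ∀ P ∈ S₀ ∪ S₁ ∪ S₂, c ∉ P := fun P hP hcP =>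
      hcS (Set.mem_iUnion₂.2 ⟨P, hP, hcP⟩)
    have hc₀ := hr₀ c fun P hP => hcS P (Or.inl (Or.inl hP))
    have hc₁ := hr₁ c fun P hP => hcS P (Or.inl (Or.inr hP))
    have hc₂ := hr₂ c fun P hP => hcS P (Or.inr hP)
    have h1 := ih _ c hc hc₁ hIa
    rw [sup_right_comm] at h1
    have h2 := ih (I ⊔ Ideal.span {c}) b hb (hrb.swap hc₂) ⟨a, ha, hra.swap hc₁, h1⟩
    rw [sup_right_comm] at h2
    exact ⟨c, hc, hc₂, h2⟩

/-- A generic linear combination of generators of `J`, with first coefficient `1`, is regular. -/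
theorem GradeGE.exists_regular_combination (k : Type*) [Field k] [Infinite k] [Algebra k R]
    [IsNoetherianRing R] {I J : Ideal R} {n m : ℕ} (h : GradeGE J (m + 1) I)
    (f : Fin (n + 1) → R) (hf : J ≤ I ⊔ Ideal.span (Set.range f)) :
    ∃ c : Fin n → k, IsRegularMod I (f 0 + ∑ j, c j • f j.succ) := by
  classical
  -- Avoidance is applied to the span of `f` itself, so that each prime misses some `f i`.
  obtain ⟨S, hS, hP, hr⟩ := exists_finite_primes (J := Ideal.span (Set.range f)) (I := I)
    fun m hm => h.mem_of_forall_mul_mem m fun j hj => by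
      obtain ⟨y, hy, z, hz, rfl⟩ := Submodule.mem_sup.1 (hf hj)
      rw [add_mul]
      exact I.add_mem (I.mul_mem_right _ hy) (hm z hz)
  let φ : (Fin (n + 1) → k) →ₗ[k] R := Fintype.linearCombination k f
  -- Over an infinite field finitely many proper subspaces do not cover the space. The hyperplane `c
  -- 0 = 0` is included so that the first coefficient can be scaled to `1`.
  let T : Finset (Subspace k (Fin (n + 1) → k)) :=
    insert (LinearMap.ker (LinearMap.proj 0))
      (hS.toFinset.image fun P => (P.restrictScalars k).comap φ)
  have hT : ⊤ ∉ T := by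
    rw [Finset.mem_insert, Finset.mem_image]
    rintro (h0 | ⟨P, hPS, h0⟩)
    · have : (Pi.single 0 1 : Fin (n + 1) → k) ∈
        LinearMap.ker (LinearMap.proj (R := k) (φ := fun _ : Fin (n + 1) => k) 0) := by
        rw [← h0]; trivial
      simp at this
    · refine (hP P (hS.mem_toFinset.1 hPS)).2 (Ideal.span_le.2 ?_)
      rintro _ ⟨i, rfl⟩
      have : (Pi.single i 1 : Fin (n + 1) → k) ∈ (P.restrictScalars k).comap φ := by
        rw [h0]; trivial
      simpa [φ, Fintype.linearCombination_apply_single] using this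
  obtain ⟨c, hc⟩ := (Set.ne_univ_iff_exists_notMem _).1 (Subspace.biUnion_ne_univ_of_top_notMem hT)
  simp only [Set.mem_iUnion, not_exists] at hc
  have hc0 : c 0 ≠ 0 := fun h0 => hc _ (Finset.mem_insert_self _ _) (by simpa using h0)
  refine ⟨fun j => (c 0)⁻¹ * c j.succ, hr _ fun P hPS hmem => ?_⟩
  refine hc _ (Finset.mem_insert_of_mem
    (Finset.mem_image_of_mem _ (hS.mem_toFinset.2 hPS))) ?_
  change φ c ∈ P
  have := (P.restrictScalars k).smul_mem (c 0) hmem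
  convert! this using 1
  simp [φ, Fintype.linearCombination_apply, Fin.sum_univ_succ, smul_add, Finset.smul_sum, smul_smul,
    mul_inv_cancel_left₀ hc0]

/-- If `J` is generated modulo `I` by `n` elements and has grade at least `n` modulo `I`, then the
syzygies of these elements modulo `I` are generated by the Koszul syzygies. -/
theorem GradeGE.exists_koszul (k : Type*) [Field k] [Infinite k] [Algebra k R]
    [IsNoetherianRing R] {J : Ideal R} (n : ℕ) :
    ∀ (I : Ideal R) (f : Fin n → R), GradeGE J n I → (∀ i, f i ∈ J) →
      J ≤ I ⊔ Ideal.span (Set.range f) → ∀ g : Fin n → R, ∑ i, f i * g i ∈ I →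
      ∃ a : Fin n → Fin n → R, (∀ i j, a i j = -a j i) ∧ (∀ i, a i i = 0) ∧
        ∀ i, g i - ∑ j, f j * a i j ∈ I := by
  induction n with
  | zero => exact fun I f _ _ _ g _ => ⟨fun _ => Fin.elim0, fun i => i.elim0, fun i => i.elim0,
      fun i => i.elim0⟩
  | succ n ih =>
    intro I f hI hfJ hJ g hg
    obtain ⟨c, hc⟩ := hI.exists_regular_combination k f hJ
    set b := f 0 + ∑ j, c j • f j.succ with hb
    have hbJ : b ∈ J := J.add_mem (hfJ 0) (J.sum_mem fun j _ =>
      Submodule.smul_of_tower_mem J (c j) (hfJ _))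
    have hIb := GradeGE.exchange n I b hbJ hc hI
    have hle : J ≤ I ⊔ Ideal.span {b} ⊔ Ideal.span (Set.range fun j : Fin n => f j.succ) := by
      refine hJ.trans (sup_le (le_sup_left.trans le_sup_left) (Ideal.span_le.2 ?_))
      have hs : ∀ j : Fin n, f j.succ ∈
          I ⊔ Ideal.span {b} ⊔ Ideal.span (Set.range fun j : Fin n => f j.succ) := fun j =>
        Ideal.mem_sup_right (Ideal.subset_span ⟨j, rfl⟩)
      rintro _ ⟨i, rfl⟩
      refine Fin.cases ?_ hs i
      have : f 0 = b - ∑ j, c j • f j.succ := by rw [hb]; ring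
      rw [SetLike.mem_coe, this]
      exact Ideal.sub_mem _ (Ideal.mem_sup_left (Ideal.mem_sup_right
        (Ideal.mem_span_singleton_self b)))
        (Ideal.sum_mem _ fun j _ => Submodule.smul_of_tower_mem _ (c j) (hs j))
    set C : Fin n → R := fun j => algebraMap k R (c j) with hC
    have hbC : b = f 0 + ∑ j, C j * f j.succ := by simp [hb, hC, Algebra.smul_def]
    -- The same relation, rewritten for the generators `b, f 1, …, f n`.
    have hsum : b * g 0 + ∑ j : Fin n, f j.succ * (g j.succ - C j * g 0) ∈ I := by
      convert hg using 1
      rw [Fin.sum_univ_succ, hbC, add_mul, Finset.sum_mul, add_assoc, ← Finset.sum_add_distrib]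
      congr 1
      exact Finset.sum_congr rfl fun j _ => by ring
    obtain ⟨a, ha, ha0, hga⟩ := ih (I ⊔ Ideal.span {b}) (fun j => f j.succ) hIb
      (fun j => hfJ _) hle (fun j => g j.succ - C j * g 0)
      (mem_sup_span_singleton_iff.2 ⟨-g 0, by convert hsum using 1; ring⟩)
    choose u hu using fun j => mem_sup_span_singleton_iff.1 (hga j)
    have hkos : ∑ j : Fin n, f j.succ * ∑ l, f l.succ * a j l = 0 := by
      simp only [Finset.mul_sum]
      rw [← Finset.sum_product']
      refine Finset.sum_involution (fun p _ => p.swap) (fun p _ => ?_) (fun p _ hp hs => hp ?_)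
        (fun _ _ => Finset.mem_univ _) fun p _ => Prod.swap_swap p
      · simp only [Prod.fst_swap, Prod.snd_swap]
        rw [ha p.2 p.1]; ring
      · have : p.1 = p.2 := congrArg Prod.snd hs
        rw [this, ha0, mul_zero, mul_zero]
    have hg0 : g 0 + ∑ j : Fin n, f j.succ * u j ∈ I := by
      apply hc
      have h1 := I.sum_mem (t := Finset.univ) fun j _ => I.mul_mem_left (f (Fin.succ j)) (hu j)
      have h2 := I.sub_mem hsum h1
      convert h2 using 1
      rw [add_sub_assoc, ← Finset.sum_sub_distrib, mul_add, ← add_zero (_ + _), ← hkos, add_assoc,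
        Finset.mul_sum, ← Finset.sum_add_distrib]
      congr 1
      exact Finset.sum_congr rfl fun j _ => by ring
    -- The Koszul matrix for `b, f 1, …, f n` has border `∓u` and block `a`; substituting `b = f 0 +
    -- ∑ C j * f j.succ` adds the `C`-terms.
    refine ⟨Fin.cases (Fin.cases 0 fun l => -u l) fun j => Fin.cases (u j) fun l =>
      a j l + C l * u j - C j * u l, fun i j => ?_, fun i => ?_, fun i => ?_⟩
    · refine Fin.cases ?_ (fun i => ?_) i <;> refine Fin.cases ?_ (fun j => ?_) j
      · simp
      · simp
      · simp
      · simp only [Fin.cases_succ]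
        rw [ha i j]; ring
    · refine Fin.cases ?_ (fun i => ?_) i
      · simp
      · simp [ha0]
    · refine Fin.cases ?_ (fun i => ?_) i
      · simpa [Fin.sum_univ_succ] using hg0
      · have h1 := I.add_mem (hu i) (I.mul_mem_left (C i) hg0)
        convert h1 using 1
        simp only [Fin.sum_univ_succ, Fin.cases_zero, Fin.cases_succ]
        have h2 : ∑ l : Fin n, f l.succ * (a i l + C l * u i - C i * u l) =
            ∑ l : Fin n, f l.succ * a i l + (∑ l, C l * f l.succ) * u i -
              C i * ∑ l : Fin n, f l.succ * u l := by
          rw [Finset.sum_mul, Finset.mul_sum, ← Finset.sum_add_distrib, ← Finset.sum_sub_distrib]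
          exact Finset.sum_congr rfl fun l _ => by ring
        rw [h2, hbC]
        ring

end Grade

/-! ### Powers of the variables as a regular sequence -/

section PowerSeries

variable {n : ℕ} {K : Type*} [Field K]

/-- The ideal `⟨xⱼᵏ : j < i⟩`, described by the vanishing of coefficients. -/
def boxIdeal (K : Type*) [Field K] (n k i : ℕ) : Ideal (MvPowerSeries (Fin n) K) where
  carrier := {f | ∀ d : Fin n →₀ ℕ, (∀ j, j.val < i → d j < k) → MvPowerSeries.coeff d f = 0}
  add_mem' hf hg d hd := by rw [map_add, hf d hd, hg d hd, add_zero]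
  zero_mem' d _ := map_zero _
  smul_mem' c f hf d hd := by
    classical
    rw [smul_eq_mul, MvPowerSeries.coeff_mul]
    refine Finset.sum_eq_zero fun p hp => ?_
    rw [hf p.2 fun j hj => lt_of_le_of_lt ?_ (hd j hj), mul_zero]
    rw [← Finset.HasAntidiagonal.mem_antidiagonal.1 hp, Finsupp.add_apply]
    exact Nat.le_add_left _ _

theorem boxIdeal_zero (k : ℕ) : boxIdeal K n k 0 = ⊥ :=
  eq_bot_iff.2 fun f hf => by
    rw [Ideal.mem_bot]
    ext d
    exact hf d fun j hj => absurd hj (Nat.not_lt_zero _)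

theorem boxIdeal_succ (k : ℕ) (i : Fin n) :
    boxIdeal K n k (i + 1) = boxIdeal K n k i ⊔ Ideal.span {MvPowerSeries.X i ^ k} := by
  refine le_antisymm (fun g hg => ?_) (sup_le (fun g hg d hd => hg d fun j hj => hd j (by omega)) ?_)
  · let g₁ : MvPowerSeries (Fin n) K := fun d => if d i < k then MvPowerSeries.coeff d g else 0
    have h₁ : ∀ d, MvPowerSeries.coeff d g₁ = if d i < k then MvPowerSeries.coeff d g else 0 :=
      fun d => rfl
    have hdvd : MvPowerSeries.X i ^ k ∣ g - g₁ := MvPowerSeries.X_pow_dvd_iff.2 fun d hd => by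
      rw [map_sub, h₁, if_pos hd, sub_self]
    rw [← sub_add_cancel g g₁]
    refine Ideal.add_mem _ (Ideal.mem_sup_right (Ideal.mem_span_singleton.2 hdvd))
      (Ideal.mem_sup_left fun d hd => ?_)
    rw [h₁]
    split_ifs with h
    · refine hg d fun j hj => ?_
      rcases Nat.lt_succ_iff_lt_or_eq.1 hj with hj | hj
      · exact hd j hj
      · rwa [Fin.ext hj]
    · rfl
  · rw [Ideal.span_singleton_le_iff_mem]
    exact fun d hd => MvPowerSeries.X_pow_dvd_iff.1 dvd_rfl d (hd i (Nat.lt_succ_self _))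

/-- Multiplication by `xᵢᵏ` shifts only the `i`-th exponent, which the condition defining `boxIdeal
K n k i` does not constrain. -/
theorem isRegularMod_boxIdeal (k : ℕ) (i : Fin n) :
    IsRegularMod (boxIdeal K n k i) (MvPowerSeries.X i ^ k) := by
  intro f hf d hd
  have := hf (Finsupp.single i k + d) fun j hj => by
    have hij : i ≠ j := by rintro rfl; exact lt_irrefl _ hj
    simpa [Finsupp.single_apply, hij] using hd j hj
  rwa [MvPowerSeries.X_pow_eq, MvPowerSeries.coeff_add_monomial_mul, one_mul] at this

theorem boxIdeal_le {J : Ideal (MvPowerSeries (Fin n) K)} {k : ℕ}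
    (hJ : ∀ i, MvPowerSeries.X i ^ k ∈ J) (i : ℕ) (hi : i ≤ n) : boxIdeal K n k i ≤ J := by
  induction i with
  | zero => rw [boxIdeal_zero]; exact bot_le
  | succ i ih =>
    have := boxIdeal_succ (K := K) k (⟨i, hi⟩ : Fin n)
    simp only at this
    rw [this]
    exact sup_le (ih (by omega)) ((Ideal.span_singleton_le_iff_mem _).2 (hJ _))

theorem gradeGE_boxIdeal {J : Ideal (MvPowerSeries (Fin n) K)} {k : ℕ}
    (hJ : ∀ i, MvPowerSeries.X i ^ k ∈ J) (m : ℕ) :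
    ∀ i, i + m = n → GradeGE J m (boxIdeal K n k i) := by
  induction m with
  | zero => exact fun _ _ => trivial
  | succ m ih =>
    intro i hi
    let i' : Fin n := ⟨i, by omega⟩
    refine ⟨MvPowerSeries.X i' ^ k, hJ _, isRegularMod_boxIdeal k i', ?_⟩
    rw [← boxIdeal_succ k i']
    exact ih (i + 1) (by omega)

theorem finite_quotient_of_X_pow_mem {J : Ideal (MvPowerSeries (Fin n) K)} {k : ℕ}
    (hJ : ∀ i, MvPowerSeries.X i ^ k ∈ J) : Module.Finite K (MvPowerSeries (Fin n) K ⧸ J) := by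
  -- The `kⁿ` coefficients with all exponents below `k` determine a series modulo `⟨xⱼᵏ⟩ ⊆ J`.
  let φ : MvPowerSeries (Fin n) K →ₗ[K] ((Fin n → Fin k) → K) :=
    LinearMap.pi fun d => MvPowerSeries.coeff (Finsupp.equivFunOnFinite.symm fun j => (d j : ℕ))
  have hker : LinearMap.ker φ ≤ J.restrictScalars K := fun f hf =>
    boxIdeal_le hJ n le_rfl fun d hd => by
      have := congrFun (LinearMap.mem_ker.1 hf) fun j => ⟨d j, hd j j.2⟩
      simpa [φ] using this
  have : Module.Finite K (MvPowerSeries (Fin n) K ⧸ LinearMap.ker φ) :=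
    Module.Finite.of_injective _
      (LinearMap.ker_eq_bot.1 (Submodule.ker_liftQ_eq_bot _ φ le_rfl le_rfl))
  exact Module.Finite.of_surjective
    ((LinearMap.ker φ).liftQ (Ideal.Quotient.mkₐ K J).toLinearMap fun x hx =>
      Ideal.Quotient.eq_zero_iff_mem.2 (hker hx)) fun x => by
    obtain ⟨y, rfl⟩ := Ideal.Quotient.mk_surjective x
    exact ⟨Submodule.Quotient.mk y, rfl⟩

end PowerSeries

theorem X_pow_mem {n k : ℕ} {J : Ideal (XSeries n)} (h : varIdeal n ^ k ≤ J) (i : Fin n) :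
    MvPowerSeries.X i ^ k ∈ J :=
  h (Ideal.pow_mem_pow (Ideal.subset_span (Set.mem_range_self i)) k)

theorem exists_koszul_syzygy {n : ℕ} {f : XSeries n}
    (hf : ∃ k : ℕ, varIdeal n ^ k ≤ jacobianIdeal f) (g : Fin n → XSeries n)
    (hg : ∑ i, MvPowerSeries.pderiv ℂ i f * g i = 0) :
    ∃ a : Fin n → Fin n → XSeries n, (∀ i j, a i j = -a j i) ∧ (∀ i, a i i = 0) ∧
      ∀ i, g i = ∑ j, MvPowerSeries.pderiv ℂ j f * a i j := by
  obtain ⟨k, hk⟩ := hf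
  have h := gradeGE_boxIdeal (X_pow_mem hk) n 0 (zero_add n)
  rw [boxIdeal_zero] at h
  obtain ⟨a, ha, ha0, hga⟩ := h.exists_koszul ℂ n ⊥ (fun i => MvPowerSeries.pderiv ℂ i f)
    (fun i => Ideal.subset_span (Set.mem_range_self i)) (by rw [bot_sup_eq]; exact le_rfl) g hg
  exact ⟨a, ha, ha0, fun i => sub_eq_zero.1 (hga i)⟩


/-! ### Commuting operators and injectivity of `s` on `H` -/

section Brieskorn

variable {n : ℕ} (f : XSeries n)

theorem pderiv_pderiv_comm (i j : Fin n) (g : XSeries n) :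
    MvPowerSeries.pderiv ℂ i (MvPowerSeries.pderiv ℂ j g) =
      MvPowerSeries.pderiv ℂ j (MvPowerSeries.pderiv ℂ i g) := by
  rcases eq_or_ne i j with rfl | h
  · rfl
  ext d
  simp only [MvPowerSeries.coeff_pderiv, add_right_comm d (Finsupp.single i 1), Finsupp.add_apply,
    Finsupp.single_eq_of_ne h, Finsupp.single_eq_of_ne h.symm, add_zero]
  ring

theorem coeff_partialX (i : Fin n) (g : SXSeries n) (k : ℕ) :
    PowerSeries.coeff k (partialX i g) = MvPowerSeries.pderiv ℂ i (PowerSeries.coeff k g) := by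
  simp [partialX]

theorem partialX_comm (i j : Fin n) (g : SXSeries n) :
    partialX i (partialX j g) = partialX j (partialX i g) := by
  ext1 k
  simp only [coeff_partialX, pderiv_pderiv_comm i j]

theorem partialX_C_mul (i : Fin n) (a : XSeries n) (g : SXSeries n) :
    partialX i (PowerSeries.C a * g) =
      PowerSeries.C a * partialX i g + PowerSeries.C (MvPowerSeries.pderiv ℂ i a) * g := by
  ext1 k
  simp only [coeff_partialX, PowerSeries.coeff_C_mul, map_add, Derivation.leibniz, smul_eq_mul]
  ring

theorem X_smul_eq (g : SXSeries n) : (PowerSeries.X : PowerSeries ℂ) • g = PowerSeries.X * g := by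
  rw [Algebra.smul_def, PowerSeries.algebraMap_apply'', PowerSeries.map_X]

theorem partialX_X_mul (i : Fin n) (g : SXSeries n) :
    partialX i (PowerSeries.X * g) = PowerSeries.X * partialX i g := by
  rw [← X_smul_eq, map_smul, X_smul_eq]

theorem brieskornOperator_apply (i : Fin n) (g : SXSeries n) :
    brieskornOperator f i g =
      PowerSeries.C (MvPowerSeries.pderiv ℂ i f) * g - PowerSeries.X * partialX i g := by
  rw [brieskornOperator, LinearMap.sub_apply, LinearMap.smul_apply, X_smul_eq]
  rfl

/-- Formally `Fᵢ = -s e^{f/s} ∂ᵢ e^{-f/s}`, a conjugate of `-s ∂ᵢ`. -/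
theorem brieskornOperator_comm (i j : Fin n) (g : SXSeries n) :
    brieskornOperator f i (brieskornOperator f j g) =
      brieskornOperator f j (brieskornOperator f i g) := by
  simp only [brieskornOperator_apply, map_sub, partialX_X_mul, partialX_C_mul,
    pderiv_pderiv_comm i j, partialX_comm i j]
  ring

theorem brieskornMap_eq_sum (g : Fin n → SXSeries n) :
    brieskornMap f g = ∑ i, brieskornOperator f i (g i) := by
  simp [brieskornMap]

theorem constantCoeff_brieskornMap (g : Fin n → SXSeries n) :
    PowerSeries.constantCoeff (brieskornMap f g) =
      ∑ i, MvPowerSeries.pderiv ℂ i f * PowerSeries.constantCoeff (g i) := by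
  simp [brieskornMap_apply]

/-- The composition of `F` with the first Koszul-type differential vanishes. -/
theorem brieskornMap_koszul (a : Fin n → Fin n → SXSeries n) (ha : ∀ i j, a i j = -a j i)
    (ha0 : ∀ i, a i i = 0) :
    brieskornMap f (fun i => ∑ j, brieskornOperator f j (a i j)) = 0 := by
  simp only [brieskornMap_eq_sum, map_sum]
  rw [← Finset.sum_product']
  refine Finset.sum_involution (fun p _ => p.swap) (fun p _ => ?_) (fun p _ hp hs => hp ?_)
    (fun _ _ => Finset.mem_univ _) fun p _ => Prod.swap_swap p
  · simp only [Prod.fst_swap, Prod.snd_swap]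
    rw [ha p.2 p.1, map_neg, map_neg, brieskornOperator_comm, add_neg_cancel]
  · have : p.1 = p.2 := congrArg Prod.snd hs
    rw [this, ha0, map_zero, map_zero]

variable {f}

/-- Multiplication by `s` is injective on `H`. -/
theorem mem_range_of_X_mul_mem_range (hf : ∃ k : ℕ, varIdeal n ^ k ≤ jacobianIdeal f)
    {h : SXSeries n} (hh : PowerSeries.X * h ∈ LinearMap.range (brieskornMap f)) :
    h ∈ LinearMap.range (brieskornMap f) := by
  obtain ⟨g, hg⟩ := hh
  obtain ⟨a, ha, ha0, hga⟩ := exists_koszul_syzygy hf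
    (fun i => PowerSeries.constantCoeff (g i)) (by
      rw [← constantCoeff_brieskornMap, hg]; simp)
  let b : Fin n → Fin n → SXSeries n := fun i j => PowerSeries.C (a i j)
  have hb := brieskornMap_koszul f b (fun i j => by simp only [b]; rw [ha i j, map_neg])
    (fun i => by simp only [b]; rw [ha0, map_zero])
  -- At `s = 0` each `Fⱼ` is multiplication by `∂ⱼ(f)`, so the lifted syzygy has the constant term
  -- of `g`.
  have hX : ∀ i, PowerSeries.X ∣ g i - ∑ j, brieskornOperator f j (b i j) := fun i => by
    rw [PowerSeries.X_dvd_iff, map_sub, hga, map_sum, sub_eq_zero]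
    simp [brieskornOperator_apply, b]
  choose g' hg' using hX
  refine ⟨g', ?_⟩
  have hX0 : (PowerSeries.X : SXSeries n) ≠ 0 := PowerSeries.X_ne_zero
  apply mul_left_cancel₀ hX0
  rw [← hg, ← sub_zero (brieskornMap f g), ← hb, ← map_sub, ← X_smul_eq, ← map_smul]
  congr 1
  funext i
  rw [Pi.smul_apply, X_smul_eq, ← hg']
  rfl

end Brieskorn

/-! ### Lifting a basis of the Jacobian algebra -/

section Basis

variable {n : ℕ} {f : XSeries n} {ι : Type*} [Fintype ι]

/-- The `ℂ[[s]]`-linear map `ℂ[[s]]^ι → ℂ[[s, x]]` given by a family of elements of `ℂ[[x]]`. -/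
noncomputable def seriesCombination (e : ι → XSeries n) :
    (ι → PowerSeries ℂ) →ₗ[PowerSeries ℂ] SXSeries n :=
  Fintype.linearCombination (PowerSeries ℂ) fun i => (PowerSeries.C (e i) : SXSeries n)

theorem seriesCombination_apply (e : ι → XSeries n) (c : ι → PowerSeries ℂ) :
    seriesCombination e c = ∑ i, c i • (PowerSeries.C (e i) : SXSeries n) :=
  Fintype.linearCombination_apply _ _ _

theorem constantCoeff_seriesCombination (e : ι → XSeries n) (c : ι → PowerSeries ℂ) :
    PowerSeries.constantCoeff (seriesCombination e c) =
      ∑ i, PowerSeries.constantCoeff (c i) • e i := by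
  rw [seriesCombination_apply, map_sum]
  refine Finset.sum_congr rfl fun i _ => ?_
  rw [Algebra.smul_def, Algebra.smul_def, PowerSeries.algebraMap_apply'', map_mul,
    PowerSeries.constantCoeff_C, ← PowerSeries.coeff_zero_eq_constantCoeff_apply,
    PowerSeries.coeff_map, PowerSeries.coeff_zero_eq_constantCoeff_apply]

theorem powerSeries_eq_zero_of_forall_X_pow_dvd {R : Type*} [CommRing R] {g : PowerSeries R}
    (h : ∀ k, PowerSeries.X ^ k ∣ g) : g = 0 := by
  ext k
  exact PowerSeries.X_pow_dvd_iff.1 (h (k + 1)) k (Nat.lt_succ_self k)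

theorem mk_eq_C_add_X_mul {R : Type*} [CommRing R] (u : ℕ → R) :
    PowerSeries.mk u = PowerSeries.C (u 0) + PowerSeries.X * PowerSeries.mk fun k => u (k + 1) := by
  ext k
  cases k with
  | zero => simp
  | succ k => simp [PowerSeries.coeff_succ_X_mul]

/-- Elements generating `ℂ[[x]]` modulo the Jacobian ideal generate `H` over `ℂ[[s]]`. -/
theorem exists_seriesCombination_add_brieskornMap (e : ι → XSeries n)
    (he : ∀ a : XSeries n, ∃ (c : ι → ℂ) (g : Fin n → XSeries n),
      a = ∑ i, c i • e i + ∑ i, MvPowerSeries.pderiv ℂ i f * g i) (h : SXSeries n) :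
    ∃ (c : ι → PowerSeries ℂ) (g : Fin n → SXSeries n),
      h = seriesCombination e c + brieskornMap f g := by
  choose c g hcg using he
  let c₀ : SXSeries n → ι → PowerSeries ℂ := fun h i =>
    PowerSeries.C (c (PowerSeries.constantCoeff h) i)
  let g₀ : SXSeries n → Fin n → SXSeries n := fun h i =>
    PowerSeries.C (g (PowerSeries.constantCoeff h) i)
  have hT : ∀ h : SXSeries n, ∃ h' : SXSeries n,
      h - (seriesCombination e (c₀ h) + brieskornMap f (g₀ h)) = PowerSeries.X * h' := fun h => by
    have : PowerSeries.X ∣ h - (seriesCombination e (c₀ h) + brieskornMap f (g₀ h)) := by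
      rw [PowerSeries.X_dvd_iff, map_sub, map_add, constantCoeff_seriesCombination,
        constantCoeff_brieskornMap, sub_eq_zero]
      simpa [c₀, g₀] using hcg (PowerSeries.constantCoeff h)
    exact this
  choose T hT using hT
  -- `T h` is the remainder of `h` divided by `s`; its `k`-th iterate supplies the coefficient of
  -- `sᵏ`.
  let cs : SXSeries n → ι → PowerSeries ℂ := fun h i =>
    PowerSeries.mk fun k => c (PowerSeries.constantCoeff (T^[k] h)) i
  let gs : SXSeries n → Fin n → SXSeries n := fun h i =>
    PowerSeries.mk fun k => g (PowerSeries.constantCoeff (T^[k] h)) i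
  have hcs : ∀ h, cs h = c₀ h + (PowerSeries.X : PowerSeries ℂ) • cs (T h) := fun h => by
    funext i
    exact mk_eq_C_add_X_mul _
  have hgs : ∀ h, gs h = g₀ h + (PowerSeries.X : PowerSeries ℂ) • gs (T h) := fun h => by
    funext i
    rw [Pi.add_apply, Pi.smul_apply, X_smul_eq]
    exact mk_eq_C_add_X_mul _
  let r : SXSeries n → SXSeries n := fun h =>
    h - (seriesCombination e (cs h) + brieskornMap f (gs h))
  have hr : ∀ h, r h = PowerSeries.X * r (T h) := fun h => by
    simp only [r]
    rw [hcs, hgs, map_add, map_add, map_smul, map_smul, X_smul_eq, X_smul_eq, mul_sub, ← hT]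
    ring
  have hdvd : ∀ k h, PowerSeries.X ^ k ∣ r h := fun k => by
    induction k with
    | zero => simp
    | succ k ih =>
      intro h
      rw [hr, pow_succ']
      exact mul_dvd_mul_left _ (ih _)
  exact ⟨cs h, gs h, sub_eq_zero.1 (powerSeries_eq_zero_of_forall_X_pow_dvd fun k => hdvd k h)⟩

/-- Elements of `ℂ[[x]]` linearly independent modulo the Jacobian ideal are linearly independent
in `H` over `ℂ[[s]]`. -/
theorem eq_zero_of_seriesCombination_mem_range
    (hf : ∃ k : ℕ, varIdeal n ^ k ≤ jacobianIdeal f) (e : ι → XSeries n)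
    (he : ∀ c : ι → ℂ, ∑ i, c i • e i ∈ jacobianIdeal f → c = 0) (c : ι → PowerSeries ℂ)
    (hc : seriesCombination e c ∈ LinearMap.range (brieskornMap f)) : c = 0 := by
  -- Independence modulo the Jacobian ideal gives `c = s c'`; injectivity of `s` on `H` returns the
  -- hypothesis for `c'`.
  have hdvd : ∀ (k : ℕ) (c : ι → PowerSeries ℂ),
      seriesCombination e c ∈ LinearMap.range (brieskornMap f) →
        ∀ i, PowerSeries.X ^ k ∣ c i := fun k => by
    induction k with
    | zero => simp
    | succ k ih =>
      intro c hc i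
      have h0 : (fun i => PowerSeries.constantCoeff (c i)) = 0 := he _ (by
        obtain ⟨g, hg⟩ := hc
        rw [← constantCoeff_seriesCombination, ← hg, constantCoeff_brieskornMap]
        exact Ideal.sum_mem _ fun j _ =>
          Ideal.mul_mem_right _ _ (Ideal.subset_span (Set.mem_range_self j)))
      have h1 : ∀ i, PowerSeries.X ∣ c i := fun i => PowerSeries.X_dvd_iff.2 (congrFun h0 i)
      choose c' hc' using h1
      have h2 : c = (PowerSeries.X : PowerSeries ℂ) • c' := funext hc'
      rw [h2, map_smul, X_smul_eq] at hc
      rw [hc', pow_succ']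
      exact mul_dvd_mul_left _ (ih c' (mem_range_of_X_mul_mem_range hf hc) i)
  exact funext fun i => powerSeries_eq_zero_of_forall_X_pow_dvd fun k => hdvd k c hc i

/-- Lifts of a basis of `ℂ[[x]]` modulo the Jacobian ideal form a basis of `H`. -/
theorem nonempty_basis_brieskornModule (hf : ∃ k : ℕ, varIdeal n ^ k ≤ jacobianIdeal f)
    (b : Module.Basis ι ℂ (XSeries n ⧸ jacobianIdeal f)) :
    Nonempty (Module.Basis ι (PowerSeries ℂ) (brieskornModule f)) := by
  choose e he using fun i => Ideal.Quotient.mk_surjective (b i)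
  have hmk : ∀ c : ι → ℂ,
      Ideal.Quotient.mk (jacobianIdeal f) (∑ i, c i • e i) = ∑ i, c i • b i := fun c => by
    rw [map_sum]
    exact Finset.sum_congr rfl fun i _ => by rw [← he]; rfl
  have hspan : ∀ a : XSeries n, ∃ (c : ι → ℂ) (g : Fin n → XSeries n),
      a = ∑ i, c i • e i + ∑ i, MvPowerSeries.pderiv ℂ i f * g i := fun a => by
    let c := b.repr (Ideal.Quotient.mk _ a)
    have h : a - ∑ i, c i • e i ∈ jacobianIdeal f := by
      rw [← Ideal.Quotient.eq_zero_iff_mem, map_sub, hmk, b.sum_repr, sub_self]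
    obtain ⟨g, hg⟩ := Ideal.mem_span_range_iff_exists_fun.1 h
    refine ⟨c, g, ?_⟩
    simp only [mul_comm _ (g _), hg]
    ring
  have hindep : ∀ c : ι → ℂ, ∑ i, c i • e i ∈ jacobianIdeal f → c = 0 := fun c hc => by
    rw [← Ideal.Quotient.eq_zero_iff_mem, hmk] at hc
    exact funext (Fintype.linearIndependent_iff.1 b.linearIndependent c hc)
  let φ := (LinearMap.range (brieskornMap f)).mkQ ∘ₗ seriesCombination e
  have hinj : Function.Injective φ := (injective_iff_map_eq_zero φ).2 fun c hc =>
    eq_zero_of_seriesCombination_mem_range hf e hindep c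
      ((Submodule.Quotient.mk_eq_zero _).1 hc)
  have hsurj : Function.Surjective φ := fun x => by
    obtain ⟨h, rfl⟩ := Submodule.mkQ_surjective _ x
    obtain ⟨c, g, rfl⟩ := exists_seriesCombination_add_brieskornMap e hspan h
    refine ⟨c, ?_⟩
    rw [map_add]
    refine left_eq_add.2 ?_
    exact (Submodule.Quotient.mk_eq_zero _).2 ⟨g, rfl⟩
  exact ⟨Module.Basis.ofEquivFun (LinearEquiv.ofBijective φ ⟨hinj, hsurj⟩).symm⟩

end Basis

end FormalBrieskorn

theorem mainTheorem3 (n : ℕ) (f : MvPowerSeries (Fin n) ℂ)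
    (hf : ∃ k : ℕ, FormalBrieskorn.varIdeal n ^ k ≤ FormalBrieskorn.jacobianIdeal f) :
    Module.Finite ℂ (MvPowerSeries (Fin n) ℂ ⧸ FormalBrieskorn.jacobianIdeal f) ∧
    Module.Free (PowerSeries ℂ) (FormalBrieskorn.brieskornModule f) ∧
    Module.Finite (PowerSeries ℂ) (FormalBrieskorn.brieskornModule f) ∧
    Module.finrank (PowerSeries ℂ) (FormalBrieskorn.brieskornModule f) =
      FormalBrieskorn.milnorNumber f := by
  obtain ⟨k, hk⟩ := hf
  have hfin : Module.Finite ℂ (MvPowerSeries (Fin n) ℂ ⧸ FormalBrieskorn.jacobianIdeal f) :=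
    FormalBrieskorn.finite_quotient_of_X_pow_mem (FormalBrieskorn.X_pow_mem hk)
  obtain ⟨b⟩ := FormalBrieskorn.nonempty_basis_brieskornModule ⟨k, hk⟩ (Module.finBasis ℂ _)
  refine ⟨hfin, Module.Free.of_basis b, Module.Finite.of_basis b, ?_⟩
  rw [Module.finrank_eq_card_basis b, Fintype.card_fin]
  rfl
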